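/- Let $R$ be a finite ring with identity (for instance a finite field or a finite quasi-Frobenius ring), $q=|R|$, $R^-=R\setminus\{0\}$, and let $\mathcal H$ be an $m\times n$ (parity-check) matrix over $R$. For $1\le j\le m$ put $\mathcal I_j=\{i:\mathcal H_{j,i}\ne 0\}$, $d_j=|\mathcal I_j|$, $d=\max_j d_j$, let $$\mathcal C_j=\Big\{(b_i)_{i\in\mathcal I_j}\in R^{\mathcal I_j}:\ \sum_{i\in\mathcal I_j}b_i\mathcal H_{j,i}=0\Big\},\qquad \mathcal T_j=\Big\{k\in\mathbb N^{R^-}:\ \sum_{\alpha\in R^-}k_\alpha\,\alpha=0 \text{ in } R,\ \sum_{\alpha\in R^-}k_\alpha\le d_j\Big\}.$$ Let $\mathcal Q$ be the set of all real $(f,w)$, with variables $f_i^{(\alpha)}$ ($1\le i\le n$, $\alpha\in R^-$) and $w_{j,b}$ ($1\le j\le m$, $b\in\mathcal C_j$), such that for all $j$: $w_{j,b}\ge 0$ for all $b\in\mathcal C_j$; $\sum_{b\in\mathcal C_j}w_{j,b}=1$; and $f_i^{(\alpha)}=\sum_{b\in\mathcal C_j,\,b_i=\alpha}w_{j,b}$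 for all $i\in\mathcal I_j$, $\alpha\in R^-$. Let $\mathcal U$ be the set of all real $(f,\sigma,z)$, with variables $f_i^{(\alpha)}$, $\sigma_{j,k}$ and $z_{i,j,k}^{(\alpha)}$ ($1\le j\le m$, $k\in\mathcal T_j$, $\alpha\in R^-$; $1\le i\le n$ for $f$ and $i\in\mathcal I_j$ for $z$), such that for all $j$: 1. (LP$_1$) $f_i^{(\alpha)}=\sum_{k\in\mathcal T_j}z_{i,j,k}^{(\alpha)}$ for all $i\in\mathcal I_j$, $\alpha\in R^-$; 2. (LP$_2$) $\sum_{k\in\mathcal T_j}\sigma_{j,k}=1$; 3. (LP$_3$) $\sum_{i\in\mathcal I_j}\ \sum_{\beta\in R^-,\ \beta\mathcal H_{j,i}=\alpha}z_{i,j,k}^{(\beta)}=k_\alpha\,\sigma_{j,k}$ for all $k\in\mathcal T_j$, $\alpha\in R^-$; 4. (LP$_4$) $z_{i,j,k}^{(\alpha)}\ge 0$ for all $i\in\mathcal I_j$, $k\in\mathcal T_j$, $\alpha\in R^-$; 5. (LP$_5$) $\sum_{\alpha\in R}\ \sum_{\beta\in R^-,\ \beta\mathcal H_{j,i}=\alpha}z_{i,j,k}^{(\beta)}\le\sigma_{j,k}$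 for all $i\in\mathcal I_j$, $k\in\mathcal T_j$. (In (LP$_5$) the term $\alpha=0$ is an empty sum, so that the outer sum may be taken over $R^-$, whenever no $\beta\neq0$ satisfies $\beta\mathcal H_{j,i}=0$; this is the case for all $i\in\mathcal I_j$ if $R$ is a field.) **Theorem.** The set $\bar{\mathcal U}=\{f:\exists\,\sigma,z \text{ such that } (f,\sigma,z)\in\mathcal U\}$ equals the set $\bar{\mathcal Q}=\{f:\exists\,w\text{ such that }(f,w)\in\mathcal Q\}$. Consequently LP decoding over $\mathcal U$ is equivalent to LP decoding over $\mathcal Q$: for every cost vector $\lambda=(\lambda_i^{(\alpha)})$ with entries in $\mathbb R\cup\{\pm\infty\}$ (with $0\cdot(\pm\infty)=0$ and $(+\infty)+(-\infty)=-\infty$), the infima of $\lambda f^T=\sum_{i,\alpha}\lambda_i^{(\alpha)}f_i^{(\alpha)}$ over $\mathcal U$ and over $\mathcal Q$ coincide, and a vector $f$ is the $f$-part of a minimizer over $\mathcal U$ if and only if it is the $f$-part of a minimizer over $\mathcal Q$. Moreover, there is an absolute constant $C$ such that for all $R$, $m$, $n$, $\mathcal H$ as above with $d\ge1$, the number of constraints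 (single linear equations and inequalities) of $\mathcal U$ is at most $C\,m\,q\,d^{\,q}$ and, if no column of $\mathcal H$ is zero, the number of variables of $\mathcal U$ is at most $C\,m\,q\,d^{\,q}$. -/

import Mathlib

namespace LPDecoding

/-- The set `R⁻ = R \ {0}` of nonzero ring elements. -/
abbrev NZ (R : Type*) [Zero R] : Type _ := {α : R // α ≠ 0}

section

open scoped Classical

variable {R : Type*} [Ring R] [Fintype R] {m n : ℕ}

/-- `I_j`, the support of row `j` of the parity-check matrix. -/
abbrev RowSupp (H : Matrix (Fin m) (Fin n) R) (j : Fin m) : Type :=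
  {i : Fin n // H j i ≠ 0}

/-- `d_j = |I_j|`. -/
noncomputable def rowDeg (H : Matrix (Fin m) (Fin n) R) (j : Fin m) : ℕ :=
  Fintype.card (RowSupp H j)

/-- `d = max_j d_j`. -/
noncomputable def maxDeg (H : Matrix (Fin m) (Fin n) R) : ℕ :=
  Finset.univ.sup (rowDeg H)

/-- The single parity check code `C_j`, with symbols indexed by `I_j`. -/
def localCode (H : Matrix (Fin m) (Fin n) R) (j : Fin m) : Set (RowSupp H j → R) :=
  {b | ∑ i, b i * H j i = 0}

/-- `T_j`: the vectors `k` of natural numbers indexed by `R⁻` with `∑ α · k_α = 0` in `R` and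
`∑ k_α ≤ d_j`. -/
def typeSet (H : Matrix (Fin m) (Fin n) R) (j : Fin m) : Set (NZ R → ℕ) :=
  {k | ∑ α, k α • (α : R) = 0 ∧ ∑ α, k α ≤ rowDeg H j}

theorem typeSet_finite (H : Matrix (Fin m) (Fin n) R) (j : Fin m) : (typeSet H j).Finite := by
  refine (Set.finite_Iic (fun _ : NZ R => rowDeg H j)).subset ?_
  intro k hk α
  exact (Finset.single_le_sum (f := k) (fun _ _ => Nat.zero_le _) (Finset.mem_univ α)).trans hk.2

noncomputable instance typeSetFintype (H : Matrix (Fin m) (Fin n) R) (j : Fin m) : Fintype (typeSet H j) :=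
  (typeSet_finite H j).fintype

/-! ### The polytope `Q` -/

/-- Index set of the variables of `Q`: `f_i^(α)` and `w_{j,b}` for `b ∈ C_j`. -/
inductive QVar (H : Matrix (Fin m) (Fin n) R) : Type _
  | f (i : Fin n) (α : NZ R)
  | w (j : Fin m) (b : localCode H j)

/-- The polytope `Q`. -/
def polytopeQ (H : Matrix (Fin m) (Fin n) R) : Set (QVar H → ℝ) :=
  {x | (∀ j, ∀ b : localCode H j, 0 ≤ x (.w j b)) ∧
    (∀ j, ∑ b : localCode H j, x (.w j b) = 1) ∧
    (∀ j, ∀ i : RowSupp H j, ∀ α : NZ R,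
      x (.f i α) = ∑ b : localCode H j with b.1 i = (α : R), x (.w j b))}

/-! ### The polytope `U` -/

/-- Index set of the variables of `U`: `f_i^(α)`, `σ_{j,k}`, and `z_{i,j,k}^(α)`, where `k ∈ T_j`
and `i ∈ I_j`. -/
inductive UVar (H : Matrix (Fin m) (Fin n) R) : Type _
  | f (i : Fin n) (α : NZ R)
  | σ (j : Fin m) (k : typeSet H j)
  | z (j : Fin m) (i : RowSupp H j) (k : typeSet H j) (α : NZ R)

/-- Index set of the constraints of `U`, one index for every single linear equation or
inequality. -/
inductive UConstraint (H : Matrix (Fin m) (Fin n) R) : Type _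
  | lp1 (j : Fin m) (i : RowSupp H j) (α : NZ R)
  | lp2 (j : Fin m)
  | lp3 (j : Fin m) (k : typeSet H j) (α : NZ R)
  | lp4 (j : Fin m) (i : RowSupp H j) (k : typeSet H j) (α : NZ R)
  | lp5 (j : Fin m) (i : RowSupp H j) (k : typeSet H j)

/-- The linear equation or inequality with a given index. In `lp5` the outer sum runs over all
`α ∈ R`; its term `α = 0` collects the nonzero `β` with `β * H j i = 0`, and is an empty sum when
there are none, for instance when `R` is a field. -/
def UConstraint.Holds {H : Matrix (Fin m) (Fin n) R} (x : UVar H → ℝ) : UConstraint H → Prop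
  | .lp1 j i α => x (.f i α) = ∑ k : typeSet H j, x (.z j i k α)
  | .lp2 j => ∑ k : typeSet H j, x (.σ j k) = 1
  | .lp3 j k α =>
      ∑ i : RowSupp H j, ∑ β ∈ Finset.univ.filter (fun β : NZ R => (β : R) * H j i = α), x (.z j i k β)
        = (k.1 α : ℝ) * x (.σ j k)
  | .lp4 j i k α => 0 ≤ x (.z j i k α)
  | .lp5 j i k =>
      ∑ α : R, ∑ β ∈ Finset.univ.filter (fun β : NZ R => (β : R) * H j i = α), x (.z j i k β) ≤ x (.σ j k)

/-- The polytope `U`. -/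
def polytopeU (H : Matrix (Fin m) (Fin n) R) : Set (UVar H → ℝ) :=
  {x | ∀ c : UConstraint H, c.Holds x}

/-! ### Projections, cost function, decoding -/

/-- The `f`-part of a point of the space containing `Q`. -/
def QVar.fPart {H : Matrix (Fin m) (Fin n) R} (x : QVar H → ℝ) : Fin n → NZ R → ℝ :=
  fun i α => x (.f i α)

/-- The `f`-part of a point of the space containing `U`. -/
def UVar.fPart {H : Matrix (Fin m) (Fin n) R} (x : UVar H → ℝ) : Fin n → NZ R → ℝ :=
  fun i α => x (.f i α)

/-- The set `Q̄` of all `f` that extend to a point of `Q`. -/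
def projQ (H : Matrix (Fin m) (Fin n) R) : Set (Fin n → NZ R → ℝ) :=
  {f | ∃ x ∈ polytopeQ H, QVar.fPart x = f}

/-- The set `Ū` of all `f` that extend to a point of `U`. -/
def projU (H : Matrix (Fin m) (Fin n) R) : Set (Fin n → NZ R → ℝ) :=
  {f | ∃ x ∈ polytopeU H, UVar.fPart x = f}

/-- The cost `λ fᵀ`. The coefficients are log-likelihood ratios, which may be infinite. -/
noncomputable def cost (lam : Fin n → NZ R → EReal) (f : Fin n → NZ R → ℝ) : EReal :=
  ∑ i, ∑ α, lam i α * (f i α : EReal)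

/-- `f` is the `f`-part of a minimizer over `Q` of the cost `λ fᵀ`. -/
def IsOptimalQ (H : Matrix (Fin m) (Fin n) R) (lam : Fin n → NZ R → EReal)
    (f : Fin n → NZ R → ℝ) : Prop :=
  ∃ x ∈ polytopeQ H, QVar.fPart x = f ∧
    ∀ y ∈ polytopeQ H, cost lam (QVar.fPart x) ≤ cost lam (QVar.fPart y)

/-- `f` is the `f`-part of a minimizer over `U` of the cost `λ fᵀ`. -/
def IsOptimalU (H : Matrix (Fin m) (Fin n) R) (lam : Fin n → NZ R → EReal)
    (f : Fin n → NZ R → ℝ) : Prop :=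
  ∃ x ∈ polytopeU H, UVar.fPart x = f ∧
    ∀ y ∈ polytopeU H, cost lam (UVar.fPart x) ≤ cost lam (UVar.fPart y)

end

end LPDecoding

/-! From `Q` to `U` one aggregates: `σ_{j,k}` is the `w`-mass of the codewords of type `k`, and `z`
the part of that mass having a given symbol at a given position.

The converse is a Birkhoff argument. A block of `U` with `σ_{j,k} > 0`, divided by `σ_{j,k}` and
completed by the symbol `0`, is a row-stochastic matrix whose entries, grouped by the value of `β *
H j i`, have integral column sums. By `mem_convexHull_indicatorMatrix` it is a mixture of words with
exactly these value counts, and such words satisfy the check. Mixing the blocks with weights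
`σ_{j,k}` gives `w`. No division in `R` is used, so zero divisors are harmless.

The cost sees only `f`, so equal projections give equal infima and minimizers. For the sizes, types
embed in multisets of `d` elements of `R`, which number `O(d ^ (q - 1))`; the index `i` costs one
more factor `d`. -/

namespace LPDecoding

/-! ### Birkhoff's theorem with grouped columns. -/

section ConvexHull

open scoped Classical

/-- A convex combination lies in a convex set as soon as its points with nonzero weight do. -/
theorem sum_smul_mem_of_ne_zero {E ι : Type*} [AddCommGroup E] [Module ℝ E] [Fintype ι] {s : Set E}
    (hs : Convex ℝ s) {w : ι → ℝ} {z : ι → E} (hw0 : ∀ i, 0 ≤ w i) (hw1 : ∑ i, w i = 1)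
    (hz : ∀ i, w i ≠ 0 → z i ∈ s) : ∑ i, w i • z i ∈ s := by
  have h1 : ∑ i with w i ≠ 0, w i = 1 := by rw [Finset.sum_filter_ne_zero, hw1]
  have h2 : ∑ i with w i ≠ 0, w i • z i = ∑ i, w i • z i := by
    refine Finset.sum_filter_of_ne fun i _ h hi => h ?_
    rw [hi, zero_smul]
  rw [← h2]
  exact hs.sum_mem (fun i _ => hw0 i) h1 fun i hi => hz i (Finset.mem_filter.1 hi).2

variable {I A B : Type*} [Fintype I] [Fintype A] [Fintype B]

/-- The 0-1 matrix of a function. -/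
noncomputable def indicatorMatrix (b : I → B) : I → B → ℝ := fun i => Pi.single (b i) 1

/-- There is a function with prescribed fibre sizes. -/
theorem exists_fun_card_fiber_eq (K : A → ℕ) (hK : ∑ α, K α = Fintype.card I) :
    ∃ c : I → A, ∀ α, Finset.card {i | c i = α} = K α := by
  have e : I ≃ Σ α, Fin (K α) := Fintype.equivOfCardEq (by simp [hK])
  refine ⟨fun i => (e i).1, fun α => ?_⟩
  have h : Finset.card {i | (e i).1 = α} = Finset.card {p : Σ α, Fin (K α) | p.1 = α} :=
    Finset.card_equiv e (by simp)
  rw [h, ← Fintype.card_subtype, Fintype.card_congr (Equiv.sigmaSubtype α), Fintype.card_fin]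

/-- A sum over `I` grouped along the fibres of `c : I → A`. -/
theorem sum_smul_eq_sum_card_smul {M : Type*}
    [AddCommMonoid M] (c : I → A) (g : A → M) :
    ∑ i, g (c i) = ∑ α, Finset.card {i | c i = α} • g α := by
  rw [← Finset.sum_fiberwise _ c]
  refine Finset.sum_congr rfl fun α _ => ?_
  rw [Finset.sum_congr rfl (g := fun _ => g α) (fun i hi => by rw [(Finset.mem_filter.1 hi).2]),
    Finset.sum_const]

/-- A finitely supported distribution is in the convex hull of the point masses on any set that
contains its support. -/
theorem mem_convexHull_single {r : B → ℝ} {s : Set B} (h0 : ∀ β, 0 ≤ r β) (h1 : ∑ β, r β = 1)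
    (hs : ∀ β, r β ≠ 0 → β ∈ s) :
    r ∈ convexHull ℝ ((fun β => (Pi.single β 1 : B → ℝ)) '' s) := by
  have h : r = ∑ β, r β • (Pi.single β 1 : B → ℝ) := by
    ext β
    simp [Finset.sum_apply, Pi.single_apply]
  rw [h]
  exact sum_smul_mem_of_ne_zero (convex_convexHull ℝ _) h0 h1
    fun β hβ => subset_convexHull ℝ _ ⟨β, hs β hβ, rfl⟩

/-- A row-stochastic matrix `x`, whose columns are grouped row by row by maps `φ i : B → A` such
that the groups have integral column sums `K α`, is a convex combination of 0-1 matrices of the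
same kind. -/
theorem mem_convexHull_indicatorMatrix (φ : I → B → A) (K : A → ℕ) (x : I → B → ℝ)
    (hx0 : ∀ i β, 0 ≤ x i β) (hrow : ∀ i, ∑ β, x i β = 1)
    (hcol : ∀ α, ∑ i, ∑ β with φ i β = α, x i β = K α) :
    x ∈ convexHull ℝ (indicatorMatrix ''
      {b : I → B | ∀ α, Finset.card {i | φ i (b i) = α} = K α}) := by
  set y : I → A → ℝ := fun i α => ∑ β with φ i β = α, x i β with hy
  have hy0 : ∀ i α, 0 ≤ y i α := fun i α => Finset.sum_nonneg fun β _ => hx0 i β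
  have hyrow : ∀ i, ∑ α, y i α = 1 := fun i => by
    rw [← hrow i]; exact Finset.sum_fiberwise _ _ _
  have hxy : ∀ i β, x i β ≤ y i (φ i β) := fun i β =>
    Finset.single_le_sum (f := x i) (fun β _ => hx0 i β) (by simp)
  have hyK : ∀ i α, y i α ≤ K α := fun i α => by
    rw [← hcol α]
    exact Finset.single_le_sum (f := fun i => y i α) (fun i _ => hy0 i α) (Finset.mem_univ i)
  have hK : ∑ α, K α = Fintype.card I := by
    have : (∑ α, (K α : ℝ)) = Fintype.card I := by
      simp_rw [← hcol]
      rw [Finset.sum_comm]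
      change ∑ i, ∑ α, y i α = _
      simp [hyrow]
    exact_mod_cast this
  -- `c` labels `|I|` new columns by groups, `K α` of them by `α`; `M` below shares the mass of
  -- group `α` equally among its copies, which makes it doubly stochastic.
  obtain ⟨c, hc⟩ := exists_fun_card_fiber_eq K hK
  have hKc : ∀ i, (K (c i) : ℝ) ≠ 0 := fun i => by
    rw [← hc]
    exact_mod_cast (Finset.card_pos.2 ⟨i, by simp⟩).ne'
  have hsumc : ∀ g : A → ℝ, ∑ i, g (c i) = ∑ α, K α * g α := fun g => by
    simp only [sum_smul_eq_sum_card_smul c g, hc, nsmul_eq_mul]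
  set M : Matrix I I ℝ := fun i i' => y i (c i') / K (c i') with hM
  have hMds : M ∈ doublyStochastic ℝ I := by
    refine mem_doublyStochastic_iff_sum.2 ⟨fun i i' => div_nonneg (hy0 _ _) (Nat.cast_nonneg _),
      fun i => ?_, fun i' => ?_⟩
    · rw [← hyrow i]
      refine (hsumc fun α => y i α / K α).trans (Finset.sum_congr rfl fun α _ => ?_)
      -- A group with `K α = 0` has no copies, but also carries no mass.
      by_cases h : (K α : ℝ) = 0
      · have := hyK i α
        have := hy0 i α
        rw [h, zero_mul]; linarith
      · field_simp
    · simp only [hM]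
      rw [← Finset.sum_div, div_eq_one_iff_eq (hKc i')]
      exact hcol _
  obtain ⟨μ, hμ0, hμ1, hμM⟩ := exists_eq_sum_perm_of_mem_doublyStochastic hMds
  have hMap : ∀ i i', M i i' = ∑ τ : Equiv.Perm I, if τ i = i' then μ τ else 0 := fun i i' => by
    rw [← hμM, Matrix.sum_apply]
    refine Finset.sum_congr rfl fun τ _ => ?_
    simp [Equiv.Perm.permMatrix, PEquiv.toMatrix_apply, eq_comm]
  -- The conditional distribution of the symbol in row `i`, given the group of column `i'`.
  set r : I → I → B → ℝ := fun i i' β => if φ i β = c i' then x i β / y i (c i') else 0 with hr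
  have hx : x = ∑ τ, μ τ • fun i => r i (τ i) := by
    ext i β
    have h1 : (∑ τ, μ τ • fun i => r i (τ i)) i β = ∑ i', M i i' * r i i' β := by
      simp_rw [hMap, Finset.sum_mul, Finset.sum_apply]
      rw [Finset.sum_comm]
      refine Finset.sum_congr rfl fun τ _ => ?_
      simp [ite_mul]
    have h2 : ∀ i', M i i' * r i i' β =
        (fun α => if φ i β = α then (y i α / K α) * (x i β / y i α) else 0) (c i') := fun i' => by
      simp [hM, hr]
    rw [h1, Finset.sum_congr rfl fun i' _ => h2 i',
      hsumc fun α => if φ i β = α then (y i α / K α) * (x i β / y i α) else 0]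
    simp only [mul_ite, mul_zero, Finset.sum_ite_eq, Finset.mem_univ, if_true]
    have hxy' := hxy i β
    have hx' := hx0 i β
    have hyK' := hyK i (φ i β)
    by_cases hy' : y i (φ i β) = 0
    · rw [hy']; simp; linarith
    · have : (K (φ i β) : ℝ) ≠ 0 := fun h => hy' (le_antisymm (h ▸ hyK') (hy0 _ _))
      field_simp
  rw [hx]
  refine sum_smul_mem_of_ne_zero (convex_convexHull ℝ _) hμ0 hμ1 fun τ hτ => ?_
  -- A permutation of nonzero weight only meets nonzero entries of `M`, so the conditional
  -- distributions it uses have total mass 1.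
  have hypos : ∀ i, y i (c (τ i)) ≠ 0 := fun i h => by
    have h1 : M i (τ i) = 0 := by simp [hM, h]
    rw [hMap] at h1
    have h2 := (Finset.sum_eq_zero_iff_of_nonneg
      (fun σ _ => by split_ifs <;> simp [hμ0])).1 h1 τ (Finset.mem_univ _)
    simp at h2
    exact hτ h2
  have hmem : (fun i => r i (τ i)) ∈ Set.pi Set.univ fun i =>
      convexHull ℝ ((fun β => (Pi.single β 1 : B → ℝ)) '' {β | φ i β = c (τ i)}) := by
    intro i _
    refine mem_convexHull_single (fun β => ?_) ?_ fun β hβ => ?_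
    · simp only [hr]
      split_ifs
      exacts [div_nonneg (hx0 _ _) (hy0 _ _), le_rfl]
    · simp only [hr]
      rw [← Finset.sum_filter, ← Finset.sum_div]
      exact div_self (hypos i)
    · by_contra h
      exact hβ (by simp only [hr]; exact if_neg h)
  -- Rows are now independent: a product of hulls is the hull of the product, and its generators
  -- pick in each row a symbol of group `c (τ i)`. As `τ` is a bijection, the group sizes stay `K
  -- α`.
  rw [← convexHull_pi] at hmem
  refine convexHull_mono ?_ hmem
  intro p hp
  choose b hb using fun i => hp i (Set.mem_univ i)
  refine ⟨b, fun α => ?_, funext fun i => (hb i).2⟩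
  rw [← hc α]
  refine Finset.card_equiv τ fun i => ?_
  have := (hb i).1
  simp only [Set.mem_ofPred_eq] at this
  simp [this]

end ConvexHull


/-! ### Equality of the two projections. -/

section Decomposition

open scoped Classical

/-- A point of the convex hull of a finite family of indicator matrices is the matrix of marginals
of a probability distribution on the family. -/
theorem exists_weights_of_mem_convexHull {I B : Type*} [Fintype I] [Fintype B] {S : Set (I → B)}
    [Fintype S] {x : I → B → ℝ} (hx : x ∈ convexHull ℝ (indicatorMatrix '' S)) :
    ∃ w : S → ℝ, (∀ b, 0 ≤ w b) ∧ ∑ b, w b = 1 ∧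
      ∀ i β, x i β = ∑ b : S with b.1 i = β, w b := by
  refine convexHull_min (t := {x : I → B → ℝ | ∃ w : S → ℝ, (∀ b, 0 ≤ w b) ∧ ∑ b, w b = 1 ∧
      ∀ i β, x i β = ∑ b : S with b.1 i = β, w b}) ?_ ?_ hx
  · rintro _ ⟨b, hb, rfl⟩
    refine ⟨Pi.single ⟨b, hb⟩ 1, fun b' => ?_, by simp, fun i β => ?_⟩
    · rw [Pi.single_apply]; split_ifs <;> simp
    · rw [Finset.sum_filter, Finset.sum_eq_single ⟨b, hb⟩ (by simp +contextual) (by simp)]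
      simp [indicatorMatrix, Pi.single_apply, eq_comm]
  · rintro x ⟨w, hw0, hw1, hw⟩ y ⟨v, hv0, hv1, hv⟩ s t hs ht hst
    refine ⟨fun b => s * w b + t * v b,
      fun b => add_nonneg (mul_nonneg hs (hw0 b)) (mul_nonneg ht (hv0 b)), ?_, fun i β => ?_⟩
    · rw [Finset.sum_add_distrib, ← Finset.mul_sum, ← Finset.mul_sum, hw1, hv1]; linarith
    · rw [Finset.sum_add_distrib, ← Finset.mul_sum, ← Finset.mul_sum, ← hw, ← hv]; rfl

variable {R : Type*} [Ring R] [Fintype R] {m n : ℕ} {H : Matrix (Fin m) (Fin n) R} {j : Fin m}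

/-- The number of occurrences of every ring element in a word of type `k`, zero included. -/
noncomputable def fullType (H : Matrix (Fin m) (Fin n) R) (j : Fin m) (k : NZ R → ℕ) (α : R) : ℕ :=
  if h : α = 0 then rowDeg H j - ∑ β, k β else k ⟨α, h⟩

theorem fullType_coe (k : NZ R → ℕ) (α : NZ R) : fullType H j k α = k α := by
  rw [fullType, dif_neg α.2]

theorem fullType_zero (k : NZ R → ℕ) : fullType H j k 0 = rowDeg H j - ∑ β, k β := by
  rw [fullType, dif_pos rfl]

theorem sum_sum_filter_mul_eq (i : RowSupp H j) (g : NZ R → ℝ) :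
    ∑ α : R, ∑ β ∈ Finset.univ.filter (fun β : NZ R => (β : R) * H j i = α), g β = ∑ β, g β :=
  Finset.sum_fiberwise _ _ _

theorem mem_localCode_of_card_eq {k : NZ R → ℕ} (hk : k ∈ typeSet H j) {b : RowSupp H j → R}
    (hb : ∀ α, Finset.card {i | b i * H j i = α} = fullType H j k α) : b ∈ localCode H j := by
  have h := sum_smul_eq_sum_card_smul (fun i : RowSupp H j => b i * H j i) (fun α => α)
  simp only [hb] at h
  rw [Fintype.sum_eq_add_sum_subtype_ne _ (0 : R), smul_zero, zero_add] at h
  simp only [fullType_coe] at h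
  exact h.trans hk.1

/-- One block of `U` with positive weight `s`, normalised, lies in the convex hull of the local
codewords. -/
theorem exists_mem_convexHull_of_block {k : NZ R → ℕ} (hk : k ∈ typeSet H j) {s : ℝ} (hs : 0 < s)
    {z : RowSupp H j → NZ R → ℝ}
    (h3 : ∀ α : NZ R, ∑ i : RowSupp H j,
      ∑ β ∈ Finset.univ.filter (fun β : NZ R => (β : R) * H j i = α), z i β = k α * s)
    (h4 : ∀ i α, 0 ≤ z i α) (h5 : ∀ i, ∑ β, z i β ≤ s) :
    ∃ x ∈ convexHull ℝ (indicatorMatrix '' localCode H j), ∀ i (α : NZ R), s * x i α = z i α := by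
  -- The mass left over in row `i`, nonnegative by LP5, goes to the symbol `0`.
  set x : RowSupp H j → R → ℝ := fun i β =>
    if h : β = 0 then 1 - (∑ γ, z i γ) / s else z i ⟨β, h⟩ / s with hx
  have hxz : ∀ i (β : NZ R), x i β = z i β / s := fun i β => by rw [hx]; exact dif_neg β.2
  have hx0 : ∀ i, x i 0 = 1 - (∑ γ, z i γ) / s := fun i => dif_pos rfl
  have hrow : ∀ i, ∑ β, x i β = 1 := fun i => by
    rw [Fintype.sum_eq_add_sum_subtype_ne _ (0 : R), hx0]
    simp only [hxz]
    rw [← Finset.sum_div]; ring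
  have hcol : ∀ α : NZ R, ∑ i : RowSupp H j, ∑ β with β * H j i = (α : R), x i β = k α := fun α => by
    rw [← mul_div_cancel_right₀ (k α : ℝ) hs.ne', ← h3, Finset.sum_div]
    refine Finset.sum_congr rfl fun i _ => ?_
    rw [Finset.sum_filter, Fintype.sum_eq_add_sum_subtype_ne _ (0 : R), zero_mul,
      if_neg (fun h => α.2 h.symm), zero_add, ← Finset.sum_filter, Finset.sum_div]
    exact Finset.sum_congr rfl fun β _ => hxz i β
  have htot : ∑ α, ∑ i : RowSupp H j, ∑ β with β * H j i = α, x i β = rowDeg H j := by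
    rw [Finset.sum_comm]
    rw [Finset.sum_congr rfl fun (i : RowSupp H j) _ =>
      (Finset.sum_fiberwise _ (fun β => β * H j i) _).trans (hrow i)]
    simp [rowDeg]
  refine ⟨x, convexHull_mono (Set.image_mono fun b hb => mem_localCode_of_card_eq hk hb)
    (mem_convexHull_indicatorMatrix (fun (i : RowSupp H j) β => β * H j i) (fullType H j k) x ?_ hrow ?_),
    fun i α => ?_⟩
  · intro i β
    by_cases h : β = 0
    · rw [h, hx0, sub_nonneg, div_le_one hs]; exact h5 i
    · exact (hxz i ⟨β, h⟩).symm ▸ div_nonneg (h4 i _) hs.le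
  · intro α
    by_cases h : α = 0
    -- The group of value `0` may contain nonzero symbols; its sum is found by subtracting the other
    -- groups from the total `d_j`.
    · rw [Fintype.sum_eq_add_sum_subtype_ne _ (0 : R)] at htot
      simp only [hcol] at htot
      rw [h, fullType_zero, Nat.cast_sub hk.2, Nat.cast_sum]
      linarith
    · exact (hcol ⟨α, h⟩).trans (congrArg Nat.cast (fullType_coe k ⟨α, h⟩).symm)
  · rw [hxz]; field_simp

/-- The constraints of `U` for one row give a distribution on the local code. -/
theorem exists_weights_of_row {σ : typeSet H j → ℝ}
    {z : RowSupp H j → typeSet H j → NZ R → ℝ} (h2 : ∑ k, σ k = 1)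
    (h3 : ∀ k (α : NZ R), ∑ i : RowSupp H j,
      ∑ β ∈ Finset.univ.filter (fun β : NZ R => (β : R) * H j i = α), z i k β = k.1 α * σ k)
    (h4 : ∀ i k α, 0 ≤ z i k α) (h5 : ∀ i k, ∑ β, z i k β ≤ σ k) :
    ∃ w : localCode H j → ℝ, (∀ b, 0 ≤ w b) ∧ ∑ b, w b = 1 ∧
      ∀ i (α : NZ R), ∑ k, z i k α = ∑ b : localCode H j with b.1 i = (α : R), w b := by
  -- Nonnegativity of `σ` is read off LP4 and LP5 at a position `i₀`; in an empty row any
  -- distribution on the code will do.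
  rcases isEmpty_or_nonempty (RowSupp H j) with he | ⟨⟨i₀⟩⟩
  · have hx : (indicatorMatrix 0 : RowSupp H j → R → ℝ) ∈
        convexHull ℝ (indicatorMatrix '' localCode H j) :=
      subset_convexHull ℝ _ ⟨0, by simp [localCode], rfl⟩
    obtain ⟨w, hw0, hw1, -⟩ := exists_weights_of_mem_convexHull hx
    exact ⟨w, hw0, hw1, fun i => he.elim i⟩
  have hσ : ∀ k, 0 ≤ σ k := fun k => (Finset.sum_nonneg fun β _ => h4 i₀ k β).trans (h5 i₀ k)
  have hx : ∀ k, ∃ x : RowSupp H j → R → ℝ,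
      (σ k ≠ 0 → x ∈ convexHull ℝ (indicatorMatrix '' localCode H j)) ∧
        ∀ i (α : NZ R), σ k * x i α = z i k α := fun k => by
    by_cases hk : σ k = 0
    · refine ⟨0, fun h => (h hk).elim, fun i α => ?_⟩
      have h := (Finset.single_le_sum (f := z i k) (fun β _ => h4 i k β)
        (Finset.mem_univ α)).trans (h5 i k)
      have := h4 i k α
      rw [hk] at h ⊢
      linarith
    · obtain ⟨x, hx, hxz⟩ := exists_mem_convexHull_of_block k.2 (lt_of_le_of_ne (hσ k) (Ne.symm hk))
        (h3 k) (fun i => h4 i k) (fun i => h5 i k)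
      exact ⟨x, fun _ => hx, hxz⟩
  choose x hxm hxz using hx
  obtain ⟨w, hw0, hw1, hw⟩ := exists_weights_of_mem_convexHull
    (sum_smul_mem_of_ne_zero (convex_convexHull ℝ _) hσ h2 hxm)
  refine ⟨w, hw0, hw1, fun i α => ?_⟩
  rw [← hw]
  simp [Finset.sum_apply, hxz]

theorem projU_subset_projQ (H : Matrix (Fin m) (Fin n) R) : projU H ⊆ projQ H := by
  rintro _ ⟨x, hx, rfl⟩
  have h : ∀ j, ∃ w : localCode H j → ℝ, (∀ b, 0 ≤ w b) ∧ ∑ b, w b = 1 ∧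
      ∀ i (α : NZ R), ∑ k, x (.z j i k α) = ∑ b : localCode H j with b.1 i = (α : R), w b :=
    fun j => exists_weights_of_row (σ := fun k => x (.σ j k)) (hx (.lp2 j))
      (fun k α => hx (.lp3 j k α)) (fun i k α => hx (.lp4 j i k α)) fun i k => by
        have := hx (.lp5 j i k)
        simp only [UConstraint.Holds, sum_sum_filter_mul_eq] at this
        exact this
  choose w hw0 hw1 hw using h
  refine ⟨fun v => match v with
    | .f i α => x (.f i α)
    | .w j b => w j b, ⟨hw0, hw1, fun j i α => ?_⟩, rfl⟩
  exact (hx (.lp1 j i α)).trans (hw j i α)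

/-- The type of a local codeword. -/
noncomputable def codewordType (b : localCode H j) : typeSet H j :=
  ⟨fun α => Finset.card {i | b.1 i * H j i = (α : R)}, by
    have h := sum_smul_eq_sum_card_smul (fun i : RowSupp H j => b.1 i * H j i) (fun α => α)
    have hb : ∑ i, b.1 i * H j i = 0 := b.2
    rw [hb, Fintype.sum_eq_add_sum_subtype_ne _ (0 : R), smul_zero, zero_add] at h
    refine ⟨h.symm, ?_⟩
    have h' := sum_smul_eq_sum_card_smul (fun i : RowSupp H j => b.1 i * H j i) (fun _ => (1 : ℕ))
    rw [Fintype.sum_eq_add_sum_subtype_ne _ (0 : R)] at h'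
    simp only [smul_eq_mul, mul_one, Finset.sum_const, Finset.card_univ] at h'
    rw [rowDeg, h']
    exact Nat.le_add_left _ _⟩

theorem projQ_subset_projU (H : Matrix (Fin m) (Fin n) R) : projQ H ⊆ projU H := by
  rintro _ ⟨x, ⟨hw0, hw1, hwf⟩, rfl⟩
  -- The slack is the mass of the words of type `k` with `b i = 0`.
  have hz : ∀ j (i : RowSupp H j) k, ∑ β : NZ R, ∑ b : localCode H j with
      codewordType b = k ∧ b.1 i = (β : R), x (.w j b) ≤
        ∑ b : localCode H j with codewordType b = k, x (.w j b) := fun j i k => by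
    rw [← Finset.sum_fiberwise _ (fun b : localCode H j => b.1 i),
      Fintype.sum_eq_add_sum_subtype_ne _ (0 : R)]
    simp only [Finset.filter_filter]
    exact le_add_of_nonneg_left (Finset.sum_nonneg fun b _ => hw0 j b)
  refine ⟨fun v => match v with
    | .f i α => x (.f i α)
    | .σ j k => ∑ b : localCode H j with codewordType b = k, x (.w j b)
    | .z j i k α => ∑ b : localCode H j with codewordType b = k ∧ b.1 i = (α : R), x (.w j b),
    fun c => ?_, rfl⟩
  cases c with
  | lp1 j i α =>
    simp only [UConstraint.Holds]
    rw [hwf j i α, ← Finset.sum_fiberwise _ codewordType]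
    refine Finset.sum_congr rfl fun k _ => ?_
    rw [Finset.filter_filter]
    simp only [and_comm]
  | lp2 j =>
    simp only [UConstraint.Holds, Finset.sum_fiberwise]
    exact hw1 j
  | lp3 j k α =>
    simp only [UConstraint.Holds]
    -- Double counting: a word of type `k` has exactly `k α` positions with `b i * H j i = α`.
    rw [Finset.mul_sum, Finset.sum_congr rfl (g := fun b : localCode H j =>
      ∑ i, if b.1 i * H j i = (α : R) then x (.w j b) else 0)]
    · rw [Finset.sum_comm]
      refine Finset.sum_congr rfl fun i _ => ?_
      rw [← Finset.sum_fiberwise _ (fun b : localCode H j => b.1 i),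
        Fintype.sum_eq_add_sum_subtype_ne _ (0 : R), Finset.sum_filter]
      have h0 : ∑ b ∈ Finset.univ.filter (fun b : localCode H j => codewordType b = k) with
          b.1 i = 0, (if b.1 i * H j i = (α : R) then x (.w j b) else 0) = 0 :=
        Finset.sum_eq_zero fun b hb => by
          rw [(Finset.mem_filter.1 hb).2, zero_mul, if_neg fun h => α.2 h.symm]
      rw [h0, zero_add]
      refine Finset.sum_congr rfl fun β _ => ?_
      rw [Finset.filter_filter, Finset.sum_congr (s₂ := Finset.univ.filter fun b : localCode H j =>
        codewordType b = k ∧ b.1 i = (β : R)) (f := fun b : localCode H j =>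
        if b.1 i * H j i = (α : R) then x (.w j b) else 0) rfl (g := fun b : localCode H j =>
        if (β : R) * H j i = (α : R) then x (.w j b) else 0)
        fun b hb => by rw [← (Finset.mem_filter.1 hb).2.2]]
      split_ifs <;> simp
    · intro b hb
      rw [← Finset.sum_filter, Finset.sum_const, nsmul_eq_mul, ← (Finset.mem_filter.1 hb).2]
      rfl
  | lp4 j i k α => exact Finset.sum_nonneg fun b _ => hw0 j b
  | lp5 j i k =>
    simp only [UConstraint.Holds, sum_sum_filter_mul_eq]
    exact hz j i k

theorem projU_eq_projQ (H : Matrix (Fin m) (Fin n) R) : projU H = projQ H :=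
  (projU_subset_projQ H).antisymm (projQ_subset_projU H)

theorem isOptimalU_iff_isOptimalQ (H : Matrix (Fin m) (Fin n) R) (lam : Fin n → NZ R → EReal)
    (f : Fin n → NZ R → ℝ) : IsOptimalU H lam f ↔ IsOptimalQ H lam f := by
  have hU : IsOptimalU H lam f ↔ f ∈ projU H ∧ ∀ g ∈ projU H, cost lam f ≤ cost lam g := by
    constructor
    · rintro ⟨x, hx, rfl, h⟩
      exact ⟨⟨x, hx, rfl⟩, by rintro _ ⟨y, hy, rfl⟩; exact h y hy⟩
    · rintro ⟨⟨x, hx, rfl⟩, h⟩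
      exact ⟨x, hx, rfl, fun y hy => h _ ⟨y, hy, rfl⟩⟩
  have hQ : IsOptimalQ H lam f ↔ f ∈ projQ H ∧ ∀ g ∈ projQ H, cost lam f ≤ cost lam g := by
    constructor
    · rintro ⟨x, hx, rfl, h⟩
      exact ⟨⟨x, hx, rfl⟩, by rintro _ ⟨y, hy, rfl⟩; exact h y hy⟩
    · rintro ⟨⟨x, hx, rfl⟩, h⟩
      exact ⟨x, hx, rfl, fun y hy => h _ ⟨y, hy, rfl⟩⟩
  rw [hU, hQ, projU_eq_projQ]

theorem iInf_cost_polytopeU (H : Matrix (Fin m) (Fin n) R) (lam : Fin n → NZ R → EReal) :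
    (⨅ x ∈ polytopeU H, cost lam (UVar.fPart x)) = ⨅ x ∈ polytopeQ H, cost lam (QVar.fPart x) := by
  have hU : (⨅ x ∈ polytopeU H, cost lam (UVar.fPart x)) = ⨅ f ∈ projU H, cost lam f :=
    (iInf_image (f := UVar.fPart) (t := polytopeU H)).symm
  have hQ : (⨅ x ∈ polytopeQ H, cost lam (QVar.fPart x)) = ⨅ f ∈ projQ H, cost lam f :=
    (iInf_image (f := QVar.fPart) (t := polytopeQ H)).symm
  rw [hU, hQ, projU_eq_projQ]

end Decomposition


/-! ### Counting types, constraints and variables. -/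

section Counting

open scoped Classical

/-- This is `(d + p).choose p`. At `p = 1` it is `d + 1 ≤ 2 * d`, and passing from `p` to `p + 1`
multiplies it by `(d + p + 1) / (p + 1) ≤ d` when `p ≥ 1`. -/
theorem multichoose_succ_le_two_mul_pow {d : ℕ} (hd : 2 ≤ d) (p : ℕ) :
    (p + 1).multichoose d ≤ 2 * d ^ p := by
  rw [Nat.multichoose_eq, show p + 1 + d - 1 = d + p by omega, Nat.choose_symm_add]
  rcases p with _ | p
  · simp
  induction p with
  | zero => simp; omega
  | succ p ih =>
    have h := Nat.add_one_mul_choose_eq (d + (p + 1)) (p + 1)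
    have h' : d + (p + 1) + 1 ≤ d * (p + 1 + 1) := by nlinarith
    refine Nat.le_of_mul_le_mul_right (c := p + 1 + 1) ?_ (by omega)
    change (d + (p + 1) + 1).choose (p + 1 + 1) * (p + 1 + 1) ≤ _
    rw [← h]
    calc (d + (p + 1) + 1) * (d + (p + 1)).choose (p + 1)
        ≤ d * (p + 1 + 1) * (2 * d ^ (p + 1)) := Nat.mul_le_mul h' ih
      _ = 2 * d ^ (p + 1 + 1) * (p + 1 + 1) := by ring

variable {R : Type*} [Ring R] [Fintype R] {m n : ℕ}

omit [Fintype R] in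
theorem rowDeg_le_maxDeg (H : Matrix (Fin m) (Fin n) R) (j : Fin m) : rowDeg H j ≤ maxDeg H :=
  Finset.le_sup (Finset.mem_univ j)

/-- Padding a type with zeros gives a multiset of size `d`, from which the type is recovered as the
multiplicities of the nonzero elements. -/
theorem card_typeSet_le_multichoose (H : Matrix (Fin m) (Fin n) R) (j : Fin m) :
    Fintype.card (typeSet H j) ≤ (Fintype.card R).multichoose (maxDeg H) := by
  rw [← Sym.card_sym_eq_multichoose]
  have hle : ∀ k : typeSet H j, ∑ α, k.1 α ≤ maxDeg H := fun k =>
    k.2.2.trans (rowDeg_le_maxDeg H j)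
  refine Fintype.card_le_of_injective (fun k => (⟨∑ α, k.1 α • {(α : R)} +
    (maxDeg H - ∑ α, k.1 α) • {0}, ?_⟩ : Sym R (maxDeg H))) fun k l hkl => ?_
  · simp [hle k]
  · refine Subtype.ext (funext fun α => ?_)
    have h := congrArg (Multiset.count (α : R)) (Subtype.ext_iff.1 hkl)
    have hα : (α : R) ≠ 0 := α.2
    simpa [Multiset.count_sum', Multiset.count_singleton, hα, Subtype.coe_inj] using h

/-- For `d = 1` the multiset bound is `q`, too weak; but a single nonzero element does not sum to
zero, so only `k = 0` remains. -/
theorem card_typeSet_le_one {H : Matrix (Fin m) (Fin n) R} {j : Fin m} (hd : rowDeg H j ≤ 1) :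
    Fintype.card (typeSet H j) ≤ 1 := by
  have h0 : ∀ k ∈ typeSet H j, k = 0 := fun k hk => by
    by_contra hne
    obtain ⟨α, hα⟩ := Function.ne_iff.1 hne
    have hs := hk.2.trans hd
    rw [← Finset.add_sum_erase _ _ (Finset.mem_univ α)] at hs
    have hα' : k α ≠ 0 := hα
    have hz : ∀ β, β ≠ α → k β = 0 := fun β hβ =>
      Finset.sum_eq_zero_iff.1 (by omega : ∑ x ∈ Finset.univ.erase α, k x = 0) β (by simp [hβ])
    have h1 : k α = 1 := by omega
    have h := hk.1
    rw [Finset.sum_eq_single α (fun β _ hβ => by rw [hz β hβ, zero_smul]) (by simp), h1,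
      one_smul] at h
    exact α.2 h
  refine Fintype.card_le_one_iff.2 fun k l => Subtype.ext ?_
  rw [h0 k k.2, h0 l l.2]

/-- The number of types is `O(d ^ (q - 1))`. -/
theorem maxDeg_mul_card_typeSet_le {H : Matrix (Fin m) (Fin n) R} (hd : 0 < maxDeg H)
    (j : Fin m) : maxDeg H * Fintype.card (typeSet H j) ≤ 2 * maxDeg H ^ Fintype.card R := by
  obtain ⟨p, hp⟩ := Nat.exists_eq_succ_of_ne_zero (Fintype.card_ne_zero (α := R))
  rcases Nat.lt_or_ge (maxDeg H) 2 with h | h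
  · have h1 : maxDeg H = 1 := by omega
    have := card_typeSet_le_one (h1 ▸ rowDeg_le_maxDeg H j)
    rw [h1, one_mul, one_pow]; omega
  · have h1 := card_typeSet_le_multichoose H j
    rw [hp] at h1 ⊢
    calc _ ≤ maxDeg H * (2 * maxDeg H ^ p) :=
          Nat.mul_le_mul_left _ (h1.trans (multichoose_succ_le_two_mul_pow h p))
      _ = _ := by rw [Nat.succ_eq_add_one]; ring

variable (H : Matrix (Fin m) (Fin n) R)

/-- The constraints of `U`, sorted by their kind. -/
def uConstraintEquiv : UConstraint H ≃
    (Σ j, RowSupp H j × NZ R) ⊕ Fin m ⊕ (Σ j, typeSet H j × NZ R) ⊕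
      (Σ j, RowSupp H j × typeSet H j × NZ R) ⊕ (Σ j, RowSupp H j × typeSet H j) where
  toFun
    | .lp1 j i α => .inl ⟨j, i, α⟩
    | .lp2 j => .inr (.inl j)
    | .lp3 j k α => .inr (.inr (.inl ⟨j, k, α⟩))
    | .lp4 j i k α => .inr (.inr (.inr (.inl ⟨j, i, k, α⟩)))
    | .lp5 j i k => .inr (.inr (.inr (.inr ⟨j, i, k⟩)))
  invFun
    | .inl ⟨j, i, α⟩ => .lp1 j i α
    | .inr (.inl j) => .lp2 j
    | .inr (.inr (.inl ⟨j, k, α⟩)) => .lp3 j k α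
    | .inr (.inr (.inr (.inl ⟨j, i, k, α⟩))) => .lp4 j i k α
    | .inr (.inr (.inr (.inr ⟨j, i, k⟩))) => .lp5 j i k
  left_inv c := by cases c <;> rfl
  right_inv c := by rcases c with _ | _ | _ | _ | _ <;> rfl

/-- The variables of `U`, sorted by their kind. -/
def uVarEquiv : UVar H ≃
    (Fin n × NZ R) ⊕ (Σ j, typeSet H j) ⊕ (Σ j, RowSupp H j × typeSet H j × NZ R) where
  toFun
    | .f i α => .inl (i, α)
    | .σ j k => .inr (.inl ⟨j, k⟩)
    | .z j i k α => .inr (.inr ⟨j, i, k, α⟩)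
  invFun
    | .inl (i, α) => .f i α
    | .inr (.inl ⟨j, k⟩) => .σ j k
    | .inr (.inr ⟨j, i, k, α⟩) => .z j i k α
  left_inv c := by cases c <;> rfl
  right_inv c := by rcases c with _ | _ | _ <;> rfl

theorem card_sigma_le {N : ℕ} {X : Fin m → Type*} [∀ j, Fintype (X j)]
    (h : ∀ j, Fintype.card (X j) ≤ N) : Fintype.card (Σ j, X j) ≤ m * N := by
  rw [Fintype.card_sigma]
  exact (Finset.sum_le_card_nsmul _ _ N fun j _ => h j).trans (by simp)

theorem card_NZ_le : Fintype.card (NZ R) ≤ Fintype.card R := Fintype.card_subtype_le _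

variable {H}

theorem card_typeSet_le (hd : 0 < maxDeg H) (j : Fin m) :
    Fintype.card (typeSet H j) ≤ 2 * maxDeg H ^ Fintype.card R :=
  (Nat.le_mul_of_pos_left _ hd).trans (maxDeg_mul_card_typeSet_le hd j)

theorem card_rowSupp_mul_typeSet_le (hd : 0 < maxDeg H) (j : Fin m) :
    Fintype.card (RowSupp H j) * Fintype.card (typeSet H j) ≤ 2 * maxDeg H ^ Fintype.card R :=
  (Nat.mul_le_mul_right _ (rowDeg_le_maxDeg H j)).trans (maxDeg_mul_card_typeSet_le hd j)

omit [Fintype R] in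
theorem card_sigma_rowSupp_le (H : Matrix (Fin m) (Fin n) R) :
    Fintype.card (Σ j, RowSupp H j) ≤ m * maxDeg H :=
  card_sigma_le (rowDeg_le_maxDeg H)

theorem maxDeg_le_pow (H : Matrix (Fin m) (Fin n) R) : maxDeg H ≤ maxDeg H ^ Fintype.card R :=
  Nat.le_self_pow Fintype.card_ne_zero _

theorem card_sigma_block_le (hd : 0 < maxDeg H) :
    Fintype.card (Σ j, RowSupp H j × typeSet H j × NZ R) ≤
      2 * (m * Fintype.card R * maxDeg H ^ Fintype.card R) := by
  refine (card_sigma_le (N := 2 * maxDeg H ^ Fintype.card R * Fintype.card R) fun j => ?_).trans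
    (le_of_eq (by ring))
  rw [Fintype.card_prod, Fintype.card_prod, ← mul_assoc]
  exact Nat.mul_le_mul (card_rowSupp_mul_typeSet_le hd j) card_NZ_le

theorem le_mul_card (a : ℕ) : a ≤ a * Fintype.card R :=
  Nat.le_mul_of_pos_right _ Fintype.card_pos

/-- LP1 to LP5 contribute at most 1, 1, 2, 2, 2 times `m * q * d ^ q`, whence the 8. -/
theorem card_uConstraint_le (hd : 0 < maxDeg H) :
    Nat.card (UConstraint H) ≤ 8 * (m * Fintype.card R * maxDeg H ^ Fintype.card R) := by
  rw [Nat.card_congr (uConstraintEquiv H), Nat.card_eq_fintype_card]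
  simp only [Fintype.card_sum]
  have h1 : Fintype.card (Σ j, RowSupp H j × NZ R) ≤
      m * (maxDeg H ^ Fintype.card R * Fintype.card R) := card_sigma_le fun j => by
    rw [Fintype.card_prod]
    exact Nat.mul_le_mul ((rowDeg_le_maxDeg H j).trans (maxDeg_le_pow H)) card_NZ_le
  have h2 : Fintype.card (Fin m) ≤ m * (maxDeg H ^ Fintype.card R * Fintype.card R) := by
    rw [Fintype.card_fin]
    exact Nat.le_mul_of_pos_right _ (Nat.mul_pos (Nat.pow_pos hd) Fintype.card_pos)
  have h3 : Fintype.card (Σ j, typeSet H j × NZ R) ≤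
      m * (2 * maxDeg H ^ Fintype.card R * Fintype.card R) := card_sigma_le fun j => by
    rw [Fintype.card_prod]
    exact Nat.mul_le_mul (card_typeSet_le hd j) card_NZ_le
  have h4 := card_sigma_block_le hd
  have h5 : Fintype.card (Σ j, RowSupp H j × typeSet H j) ≤
      m * (2 * maxDeg H ^ Fintype.card R * Fintype.card R) := card_sigma_le fun j => by
    rw [Fintype.card_prod]
    exact (card_rowSupp_mul_typeSet_le hd j).trans (le_mul_card _)
  nlinarith

theorem card_uVar_le (hd : 0 < maxDeg H) (hH : ∀ i, ∃ j, H j i ≠ 0) :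
    Nat.card (UVar H) ≤ 8 * (m * Fintype.card R * maxDeg H ^ Fintype.card R) := by
  rw [Nat.card_congr (uVarEquiv H), Nat.card_eq_fintype_card]
  simp only [Fintype.card_sum]
  have hn : n ≤ m * maxDeg H := by
    -- Each column has a nonzero entry, so the `n` columns inject into the at most `m * d` nonzero
    -- positions of `H`.
    choose j hj using hH
    have := Fintype.card_le_of_injective (fun i => (⟨j i, i, hj i⟩ : Σ j, RowSupp H j))
      fun i i' h => by
        have := congrArg (fun p : Σ j, RowSupp H j => (p.2 : Fin n)) h
        exact this
    rw [Fintype.card_fin] at this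
    exact this.trans (card_sigma_rowSupp_le H)
  have h1 : Fintype.card (Fin n × NZ R) ≤
      m * maxDeg H ^ Fintype.card R * Fintype.card R := by
    rw [Fintype.card_prod, Fintype.card_fin]
    exact Nat.mul_le_mul (hn.trans (Nat.mul_le_mul_left _ (maxDeg_le_pow H))) card_NZ_le
  have h2 : Fintype.card (Σ j, typeSet H j) ≤
      m * (2 * maxDeg H ^ Fintype.card R * Fintype.card R) :=
    card_sigma_le fun j => (card_typeSet_le hd j).trans (le_mul_card _)
  have h3 := card_sigma_block_le hd
  nlinarith

end Counting

end LPDecoding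
open LPDecoding in
theorem mainTheorem1 :
    (∀ (R : Type*) [Ring R] [Fintype R] (m n : ℕ) (H : Matrix (Fin m) (Fin n) R),
      projU H = projQ H ∧
      ∀ lam : Fin n → NZ R → EReal,
        (∀ f : Fin n → NZ R → ℝ, IsOptimalU H lam f ↔ IsOptimalQ H lam f) ∧
        (⨅ x ∈ polytopeU H, cost lam (UVar.fPart x)) =
          ⨅ x ∈ polytopeQ H, cost lam (QVar.fPart x)) ∧
    ∃ C : ℕ, ∀ (R : Type*) [Ring R] [Fintype R] (m n : ℕ) (H : Matrix (Fin m) (Fin n) R),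
      0 < maxDeg H →
        (Finite (UConstraint H) ∧
          Nat.card (UConstraint H)
            ≤ C * (m * Fintype.card R * maxDeg H ^ Fintype.card R)) ∧
        (Finite (UVar H) ∧
          ((∀ i, ∃ j, H j i ≠ 0) →
            Nat.card (UVar H)
              ≤ C * (m * Fintype.card R * maxDeg H ^ Fintype.card R))) := by
  refine ⟨fun R _ _ m n H => ⟨projU_eq_projQ H, fun lam =>
    ⟨isOptimalU_iff_isOptimalQ H lam, iInf_cost_polytopeU H lam⟩⟩,
    8, fun R _ _ m n H hd => ⟨⟨?_, card_uConstraint_le hd⟩, ?_, card_uVar_le hd⟩⟩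
  · classical exact .of_equiv _ (uConstraintEquiv H).symm
  · classical exact .of_equiv _ (uVarEquiv H).symm
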